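/- Let $Q$ be a quiver with vertex set $I$, and let $\boldsymbol{n}, \boldsymbol{m} \in \mathbb{N}^I$. For $i \in I$ let $$I_i^* = \bigoplus_{p \text{ path in } Q \text{ starting at } i} \mathbb{C} p$$ be the representation of $Q$ (equivalently, the module over the path algebra $\mathbb{C}Q$) generated by the empty path at $i$: its component at a vertex $j$ has as basis the paths from $i$ to $j$ (including the empty path if $j = i$), and an arrow $e$ acts by $p \mapsto ep$. For a representation $T = (T_i)_{i \in I}$, $\phi_e : T_i \to T_j$ for $e = \overrightarrow{ij}$, let $\mathrm{Gr}_{\boldsymbol{n}}(T)$ be the quiver Grassmannian, which parametrizes families of surjections $(\pi_i : T_i \twoheadrightarrow \mathbb{C}^{n_i})_{i \in I}$ such that every $\phi_e$ takes $\mathrm{Ker}\,\pi_i$ to $\mathrm{Ker}\,\pi_j$, modulo $\prod_{i} GL_{n_i}$. Let $M^{\mathrm{stab}}_{\boldsymbol{n},\boldsymbol{m}}$ be the moduli space which parametrizes collections of linear maps $(\psi_i : \mathbb{C}^{m_i} \to \mathbb{C}^{n_i})_{i \in I}$, $(\phi_e : \mathbb{C}^{n_i} \to \mathbb{C}^{n_j})_{e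 = \overrightarrow{ij}}$ that are stable (no proper subrepresentation contains the images of all the $\psi_i$), modulo $\prod_i GL_{n_i}$. Both are regarded as algebro-geometric moduli spaces, through their functors of points on commutative $\mathbb{C}$-algebras $R$: - $\mathrm{Gr}_{\boldsymbol{n}}(T)(R)$ is the set of families of $R$-submodules $N_i \subseteq R \otimes_{\mathbb{C}} T_i$ such that each $(R \otimes T_i)/N_i$ is finitely generated projective of constant rank $n_i$ and each $1 \otimes \phi_e$ takes $N_i$ to $N_j$; - $M^{\mathrm{stab}}_{\boldsymbol{n},\boldsymbol{m}}(R)$ is the set of isomorphism classes of collections $(V_i, \psi_i : R^{m_i} \to V_i, \phi_e : V_i \to V_j)$, with $V_i$ a finitely generated projective $R$-module of constant rank $n_i$ and $\psi_i$, $\phi_e$ $R$-linear, such that $K \otimes_R V$ is stable for every homomorphism from $R$ to a field $K$. Then there is an isomorphism $$\mathrm{Gr}_{\boldsymbol{n}}\Big(\bigoplus_{i \in I} (I_i^*)^{\oplus m_i}\Big) \cong M^{\mathrm{stab}}_{\boldsymbol{n},\boldsymbol{m}},$$ that is, bijections between the sets of $R$-points, for all $R$, which are natural in $R$. -/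

import Mathlib

open CategoryTheory TensorProduct

universe u v w w'

noncomputable section

/-- A representation of the quiver `I` over a commutative ring `k`: a `k`-module at each vertex and
a `k`-linear map along each arrow. -/
structure QuiverRep (k : Type u) [CommRing k] (I : Type v) [Quiver.{w} I] where
  obj : I → Type w'
  [addCommGroup : ∀ i, AddCommGroup (obj i)]
  [module : ∀ i, Module k (obj i)]
  map : ∀ {i j : I}, (i ⟶ j) → obj i →ₗ[k] obj j

attribute [instance] QuiverRep.addCommGroup QuiverRep.module

namespace QuiverRep

variable {k : Type u} [CommRing k] {I : Type v} [Quiver.{w} I]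

/-- The direct sum of a family of quiver representations. -/
def directSum {κ : Type*} (T : κ → QuiverRep.{u, v, w, w'} k I) : QuiverRep k I where
  obj j := DirectSum κ fun a => (T a).obj j
  map e := DirectSum.lmap fun a => (T a).map e

/-- The extension of scalars of a quiver representation. -/
def baseChange (S : Type*) [CommRing S] [Algebra k S] (T : QuiverRep.{u, v, w, w'} k I) :
    QuiverRep S I where
  obj i := S ⊗[k] T.obj i
  map e := (T.map e).baseChange S

variable (k) in
/-- The representation `I_i^*`: at the vertex `j` it has a basis indexed by the paths from `i`
to `j` (including the empty path when `j = i`), and an arrow `e` acts by `p ↦ e p`. -/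
def dualInjective (i : I) : QuiverRep k I where
  obj j := Quiver.Path i j →₀ k
  map e := Finsupp.lmapDomain k k fun p => p.cons e

variable (k) in
/-- The representation `⨁_i (I_i^*)^{⊕ m_i}`. -/
def framingRep (m : I → ℕ) : QuiverRep k I :=
  directSum fun a : Σ i : I, Fin (m i) => dualInjective k a.1

end QuiverRep

section Grassmannian

variable {I : Type v} [Quiver.{w} I]

/-- The points of the quiver Grassmannian `Gr_n(T)` over a commutative `ℂ`-algebra `R`: families of
submodules `N_i` (the kernels of the `π_i`) of the `R ⊗ T_i`, such that `(R ⊗ T_i) / N_i` is finite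
projective over `R` of constant rank `n_i`, and such that the maps of `T` take `N_i` to `N_j`. -/
def QuiverGrassmannian (T : QuiverRep.{0, v, w, w'} ℂ I) (n : I → ℕ)
    (R : Type u) [CommRing R] [Algebra ℂ R] : Type (max u v w') :=
  { N : ∀ i, Module.Grassmannian R ((T.baseChange R).obj i) (n i) //
    ∀ ⦃i j : I⦄ (e : i ⟶ j),
      (N i).toSubmodule ≤ (N j).toSubmodule.comap ((T.baseChange R).map e) }

/-- Pull-back of points of the quiver Grassmannian along a homomorphism `R → S`: the kernels
`N_i` are replaced by the kernels of `S ⊗ T_i → S ⊗_R ((R ⊗ T_i) / N_i)`. -/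
def QuiverGrassmannian.map {T : QuiverRep.{0, v, w, w'} ℂ I} {n : I → ℕ}
    {R S : Type u} [CommRing R] [Algebra ℂ R] [CommRing S] [Algebra ℂ S] (f : R →ₐ[ℂ] S)
    (N : QuiverGrassmannian T n R) : QuiverGrassmannian T n S :=
  ⟨fun i => Module.Grassmannian.map f (N.1 i), by
    intro i j e x hx
    let : Algebra R S := f.toAlgebra
    have : IsScalarTower ℂ R S :=
      IsScalarTower.of_algebraMap_eq' <| IsScalarTower.algebraMap_eq ℂ R S
    replace hx : Module.Grassmannian.baseChangeMkQ S (N.1 i).toSubmodule x = 0 := hx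
    change Module.Grassmannian.baseChangeMkQ S (N.1 j).toSubmodule
      ((T.map e).baseChange S x) = 0
    let q : ((R ⊗[ℂ] T.obj i) ⧸ (N.1 i).toSubmodule) →ₗ[R]
        ((R ⊗[ℂ] T.obj j) ⧸ (N.1 j).toSubmodule) :=
      Submodule.mapQ _ _ ((T.map e).baseChange R) (N.2 e)
    have key : Module.Grassmannian.baseChangeMkQ S (N.1 j).toSubmodule ∘ₗ
          (T.map e).baseChange S =
        q.baseChange S ∘ₗ Module.Grassmannian.baseChangeMkQ S (N.1 i).toSubmodule := by
      ext t
      change Module.Grassmannian.baseChangeMkQ S (N.1 j).toSubmodule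
          ((T.map e).baseChange S (1 ⊗ₜ t)) =
        q.baseChange S (Module.Grassmannian.baseChangeMkQ S (N.1 i).toSubmodule (1 ⊗ₜ t))
      rw [LinearMap.baseChange_tmul]
      simp only [Module.Grassmannian.baseChangeMkQ, LinearMap.comp_apply, LinearEquiv.coe_coe,
        AlgebraTensorModule.cancelBaseChange_symm_tmul, LinearMap.baseChange_tmul]
      rfl
    have := LinearMap.congr_fun key x
    exact this.trans ((congrArg (q.baseChange S) hx).trans (map_zero _))⟩

/-- The quiver Grassmannian `Gr_n(T)`, as a functor of points on commutative `ℂ`-algebras. It is the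
closed subfunctor of the product of the Grassmannian functors of the `T_i` that is cut out by the
compatibility with the arrows. -/
def quiverGrassmannian (T : QuiverRep.{0, v, w, w'} ℂ I) (n : I → ℕ) :
    CommAlgCat.{u} ℂ ⥤ Type (max u v w') where
  obj R := QuiverGrassmannian T n R
  map f := ↾QuiverGrassmannian.map f.hom
  map_id R := by
    ext N
    exact Subtype.ext (funext fun i => Module.Grassmannian.map_id (n i) R (N.1 i))
  map_comp f g := by
    ext N
    exact Subtype.ext (funext fun i => Module.Grassmannian.map_comp (n i) f.hom g.hom (N.1 i))

end Grassmannian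

/-- A framed quiver representation over a commutative ring `R` with framing vector `m`: a quiver
representation `V` together with linear maps `ψ_i : R^{m_i} → V_i`. -/
structure FramedRep (R : Type u) [CommRing R] {I : Type v} [Quiver.{w} I] (m : I → ℕ) extends
    QuiverRep.{u, v, w, w'} R I where
  framing : ∀ i, (Fin (m i) → R) →ₗ[R] obj i

namespace FramedRep

variable {R : Type u} [CommRing R] {I : Type v} [Quiver.{w} I] {m : I → ℕ}

/-- Extension of scalars of framed representations: the `l`-th basis vector of `S^{m_i}` is
sent to `1 ⊗ ψ_i (l-th basis vector)`. -/
def baseChange (S : Type*) [CommRing S] [Algebra R S] (X : FramedRep.{u, v, w, w'} R m) :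
    FramedRep S m where
  toQuiverRep := X.toQuiverRep.baseChange S
  framing i := Fintype.linearCombination S fun l =>
    ((1 : S) ⊗ₜ[R] X.framing i (Pi.single l 1) : S ⊗[R] X.obj i)

/-- Isomorphisms of framed representations (which are the identity on the framing spaces). -/
structure Iso (X Y : FramedRep.{u, v, w, w'} R m) where
  equiv : ∀ i, X.obj i ≃ₗ[R] Y.obj i
  comm_map : ∀ ⦃i j : I⦄ (e : i ⟶ j) (x : X.obj i),
    equiv j (X.map e x) = Y.map e (equiv i x)
  comm_framing : ∀ (i : I) (x : Fin (m i) → R), equiv i (X.framing i x) = Y.framing i x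

/-- Stability, over a field: no proper subrepresentation contains the images of all the `ψ_i`. -/
def IsStable {K : Type u} [Field K] (X : FramedRep.{u, v, w, w'} K m) : Prop :=
  ∀ W : ∀ i, Submodule K (X.obj i),
    (∀ ⦃i j : I⦄ (e : i ⟶ j), W i ≤ (W j).comap (X.map e)) →
    (∀ i, LinearMap.range (X.framing i) ≤ W i) → ∀ i, W i = ⊤

/-- A family over `Spec R` of stable framed `n`-dimensional representations: each `V_i` is a
vector bundle of rank `n_i`, and the fibre at each field-valued point of `Spec R` is stable. -/
structure IsStableFamily (n : I → ℕ) (X : FramedRep.{u, v, w, w'} R m) : Prop where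
  finite : ∀ i, Module.Finite R (X.obj i)
  projective : ∀ i, Module.Projective R (X.obj i)
  rank_eq : ∀ (i : I) (p : PrimeSpectrum R), Module.rankAtStalk (R := R) (X.obj i) p = n i
  stable : ∀ (K : Type u) [Field K] [Algebra R K], (X.baseChange K).IsStable

namespace Iso

variable {X Y Z : FramedRep.{u, v, w, w'} R m}

def refl (X : FramedRep.{u, v, w, w'} R m) : Iso X X :=
  ⟨fun _ => LinearEquiv.refl _ _, fun _ _ _ _ => rfl, fun _ _ => rfl⟩

def symm (a : Iso X Y) : Iso Y X where
  equiv i := (a.equiv i).symm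
  comm_map i j e x := by
    rw [LinearEquiv.symm_apply_eq, a.comm_map, LinearEquiv.apply_symm_apply]
  comm_framing i x := by rw [LinearEquiv.symm_apply_eq, a.comm_framing]

def trans (a : Iso X Y) (b : Iso Y Z) : Iso X Z where
  equiv i := (a.equiv i).trans (b.equiv i)
  comm_map i j e x := by simp [a.comm_map, b.comm_map]
  comm_framing i x := by simp [a.comm_framing, b.comm_framing]

def baseChange (S : Type*) [CommRing S] [Algebra R S] (a : Iso X Y) :
    Iso (X.baseChange S) (Y.baseChange S) where
  equiv i := (a.equiv i).baseChange R S _ _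
  comm_map i j e x := by
    have : ((a.equiv j).toLinearMap.baseChange S) ∘ₗ (X.map e).baseChange S =
        (Y.map e).baseChange S ∘ₗ (a.equiv i).toLinearMap.baseChange S := by
      rw [← LinearMap.baseChange_comp, ← LinearMap.baseChange_comp]
      congr 1
      ext y
      exact a.comm_map e y
    exact LinearMap.congr_fun this x
  comm_framing i x := by
    change (a.equiv i).baseChange R S _ _ (Fintype.linearCombination S (fun l =>
      ((1 : S) ⊗ₜ[R] X.framing i (Pi.single l 1) : S ⊗[R] X.obj i)) x) =
      Fintype.linearCombination S (fun l =>
        ((1 : S) ⊗ₜ[R] Y.framing i (Pi.single l 1) : S ⊗[R] Y.obj i)) x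
    simp [Fintype.linearCombination_apply, a.comm_framing]

end Iso

/-- Extension of scalars from `R` to itself does nothing. -/
def baseChangeSelf (X : FramedRep.{u, v, w, u} R m) : Iso (X.baseChange R) X where
  equiv i := TensorProduct.lid R (X.obj i)
  comm_map i j e x := by
    have : (TensorProduct.lid R (X.obj j)).toLinearMap ∘ₗ (X.map e).baseChange R =
        X.map e ∘ₗ (TensorProduct.lid R (X.obj i)).toLinearMap := by
      ext y
      simp
    exact LinearMap.congr_fun this x
  comm_framing i x := by
    change TensorProduct.lid R (X.obj i) (Fintype.linearCombination R (fun l =>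
      ((1 : R) ⊗ₜ[R] X.framing i (Pi.single l 1) : R ⊗[R] X.obj i)) x) = X.framing i x
    conv_rhs => rw [pi_eq_sum_univ' x, map_sum]
    rw [Fintype.linearCombination_apply, map_sum]
    refine Finset.sum_congr rfl fun l _ => ?_
    rw [LinearEquiv.map_smul, LinearMap.map_smul, TensorProduct.lid_tmul, one_smul]

/-- Two-step extension of scalars agrees with one-step extension of scalars. -/
def cancelBaseChange (S T : Type u) [CommRing S] [CommRing T] [Algebra R S] [Algebra R T]
    [Algebra S T] [IsScalarTower R S T] (X : FramedRep.{u, v, w, u} R m) :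
    Iso ((X.baseChange S).baseChange T) (X.baseChange T) where
  equiv i := AlgebraTensorModule.cancelBaseChange R S T T (X.obj i)
  comm_map i j e x := by
    have : (AlgebraTensorModule.cancelBaseChange R S T T (X.obj j)).toLinearMap ∘ₗ
        ((X.map e).baseChange S).baseChange T =
        (X.map e).baseChange T ∘ₗ
          (AlgebraTensorModule.cancelBaseChange R S T T (X.obj i)).toLinearMap := by
      ext y
      simp
    exact LinearMap.congr_fun this x
  comm_framing i x := by
    change AlgebraTensorModule.cancelBaseChange R S T T (X.obj i)
      (Fintype.linearCombination T (fun l => ((1 : T) ⊗ₜ[S] Fintype.linearCombination S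
        (fun l' => ((1 : S) ⊗ₜ[R] X.framing i (Pi.single l' 1) : S ⊗[R] X.obj i))
        (Pi.single l 1) : T ⊗[S] (S ⊗[R] X.obj i))) x) =
      Fintype.linearCombination T (fun l =>
        ((1 : T) ⊗ₜ[R] X.framing i (Pi.single l 1) : T ⊗[R] X.obj i)) x
    simp [Fintype.linearCombination_apply]

lemma IsStable.of_iso {K : Type u} [Field K] {X Y : FramedRep.{u, v, w, w'} K m}
    (hX : X.IsStable) (a : Iso X Y) : Y.IsStable := by
  intro W hW hf i
  have h := hX (fun i => (W i).comap (a.equiv i).toLinearMap) ?_ ?_ i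
  · rw [eq_top_iff]
    intro y _
    have : (a.equiv i).symm y ∈ (W i).comap (a.equiv i).toLinearMap := h ▸ Submodule.mem_top
    simpa using this
  · intro i j e x hx
    have := hW e hx
    simp only [Submodule.mem_comap, LinearEquiv.coe_coe] at this ⊢
    rwa [a.comm_map]
  · rintro i _ ⟨x, rfl⟩
    simp only [Submodule.mem_comap, LinearEquiv.coe_coe]
    rw [a.comm_framing]
    exact hf i ⟨x, rfl⟩

variable {n : I → ℕ}

lemma IsStableFamily.of_iso {X Y : FramedRep.{u, v, w, w'} R m}
    (hX : X.IsStableFamily n) (a : Iso X Y) : Y.IsStableFamily n where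
  finite i := have := hX.finite i; Module.Finite.equiv (a.equiv i)
  projective i := have := hX.projective i; Module.Projective.of_equiv (a.equiv i)
  rank_eq i p := by
    rw [← Module.rankAtStalk_eq_of_equiv (a.equiv i), hX.rank_eq]
  stable K _ _ := (hX.stable K).of_iso (a.baseChange K)

lemma IsStableFamily.baseChange {X : FramedRep.{u, v, w, u} R m} (hX : X.IsStableFamily n)
    (S : Type u) [CommRing S] [Algebra R S] : (X.baseChange S).IsStableFamily n where
  finite i := have := hX.finite i; inferInstanceAs (Module.Finite S (S ⊗[R] X.obj i))
  projective i := have := hX.projective i; inferInstanceAs (Module.Projective S (S ⊗[R] X.obj i))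
  rank_eq i p := by
    have := hX.finite i
    have := hX.projective i
    exact (Module.rankAtStalk_baseChange (R := R) (M := X.obj i) p).trans (hX.rank_eq i _)
  stable K _ _ := by
    let : Algebra R K := ((algebraMap S K).comp (algebraMap R S)).toAlgebra
    have : IsScalarTower R S K := IsScalarTower.of_algebraMap_eq' rfl
    exact (hX.stable K).of_iso (X.cancelBaseChange S K).symm

end FramedRep

section Moduli

variable {I : Type v} [Quiver.{w} I]

/-- Stable families of framed `n`-dimensional representations over `Spec R`. -/
abbrev StableFamily (n m : I → ℕ) (R : Type u) [CommRing R] : Type (max (u + 1) v w) :=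
  { X : FramedRep.{u, v, w, u} R m // X.IsStableFamily n }

instance StableFamily.setoid (n m : I → ℕ) (R : Type u) [CommRing R] :
    Setoid (StableFamily n m R) where
  r X Y := Nonempty (FramedRep.Iso X.1 Y.1)
  iseqv := ⟨fun X => ⟨.refl X.1⟩, fun ⟨a⟩ => ⟨a.symm⟩, fun ⟨a⟩ ⟨b⟩ => ⟨a.trans b⟩⟩

/-- Pull-back of stable families along a ring homomorphism `R → S`. -/
def StableFamily.map {n m : I → ℕ} {R S : Type u} [CommRing R] [CommRing S] (f : R →+* S)
    (X : StableFamily n m R) : StableFamily n m S :=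
  letI := f.toAlgebra
  ⟨X.1.baseChange S, X.2.baseChange S⟩

/-- The moduli space `M^stab_{n,m}` of stable framed `n`-dimensional representations with framing
vector `m`, as a functor of points on commutative `ℂ`-algebras: `R` is sent to the set of
isomorphism classes of stable families over `Spec R`. These are the `R`-points of the quotient stack
of the stable locus in `⨁ Hom(ℂ^{m_i}, ℂ^{n_i}) ⊕ ⨁ Hom(ℂ^{n_i}, ℂ^{n_j})` by `∏ GL_{n_i}`, as a torsor
under `GL_n` is a vector bundle of rank `n`. Passing to isomorphism classes loses nothing, since
stable framed representations have no non-trivial automorphisms. -/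
def stableModuli (n m : I → ℕ) : CommAlgCat.{u} ℂ ⥤ Type (max (u + 1) v w) where
  obj R := Quotient (StableFamily.setoid n m R)
  map f := ↾Quotient.map (StableFamily.map (f.hom : _ →ₐ[ℂ] _).toRingHom) fun X Y ⟨a⟩ =>
    letI := (f.hom : _ →ₐ[ℂ] _).toRingHom.toAlgebra
    ⟨a.baseChange _⟩
  map_id R := by
    ext x
    induction x using Quotient.inductionOn with
    | h X => exact Quotient.sound ⟨X.1.baseChangeSelf⟩
  map_comp {R S T} f g := by
    ext x
    induction x using Quotient.inductionOn with
    | h X =>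
      let : Algebra R S := f.hom.toRingHom.toAlgebra
      let : Algebra S T := g.hom.toRingHom.toAlgebra
      let : Algebra R T := (f ≫ g).hom.toRingHom.toAlgebra
      have : IsScalarTower R S T := IsScalarTower.of_algebraMap_eq' rfl
      exact Quotient.sound ⟨(X.1.cancelBaseChange S T).symm⟩

end Moduli

end

open CategoryTheory TensorProduct

noncomputable section

/-! The representation `framingRep` is free on the framing vectors: over `R` it has as basis the
paths `p` starting at a framing vector `a`. Hence a framed representation `X` amounts to a morphism
`ev` from it to `X`, sending `(a, p)` to `p` applied to the framing vector `a`, whose image is the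
subrepresentation generated by the framing.

Stability of all fibres is equivalent to generation over `R` when the `V_i` are finite: one
direction is Nakayama (`IsStableFamily.isGenerated`), the other a pull-back of submodules
(`IsGenerated.isStable_baseChange`). So for stable families `ev` is surjective, and `X ↦ ker ev` is
inverse to `N ↦ quotientRep N` up to isomorphism (`eq_of_iso`, `quotientRepIso`). Naturality in `R`
is the compatibility of `ev` with base change (`ev_baseChange_quotientRep`). -/

lemma DFinsupp.basis_apply {ι k : Type*} [DecidableEq ι] [Semiring k] {η : ι → Type*}
    {M : ι → Type*} [∀ i, AddCommMonoid (M i)] [∀ i, Module k (M i)]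
    (b : ∀ i, Module.Basis (η i) k (M i)) (i : ι) (j : η i) :
    DFinsupp.basis b ⟨i, j⟩ = DFinsupp.single i (b i j) := by
  apply (DFinsupp.basis b).repr.injective
  rw [Module.Basis.repr_self]
  symm
  refine (LinearEquiv.symm_apply_eq _).2 ?_
  refine (DFinsupp.mapRange_single (f := fun i => (b i).repr)
    (hf := fun i => map_zero _)).trans ?_
  refine Eq.trans ?_ (sigmaFinsuppEquivDFinsupp_single ⟨i, j⟩ (1 : k)).symm
  exact congrArg _ ((b i).repr_self j)

/-- A submodule of a finite module that exhausts all fibres is everything. -/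
lemma Submodule.eq_top_of_surjective_baseChange_residueField {R M : Type*} [CommRing R]
    [AddCommGroup M] [Module R M] [Module.Finite R M] (W : Submodule R M)
    (h : ∀ p : PrimeSpectrum R,
      Function.Surjective (W.subtype.baseChange p.asIdeal.ResidueField)) : W = ⊤ := by
  -- Nakayama: the support of the finite module `M ⧸ W` is the set of primes at which its fibre is
  -- non-zero, so it suffices that every fibre vanishes.
  rw [← Submodule.Quotient.subsingleton_iff, ← Module.support_eq_empty_iff (R := R),
    Set.eq_empty_iff_forall_notMem]
  intro p hp
  rw [Module.mem_support_iff_nontrivial_residueField_tensorProduct] at hp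
  refine not_subsingleton_iff_nontrivial.2 hp (subsingleton_of_forall_eq 0 fun y => ?_)
  obtain ⟨x, rfl⟩ := LinearMap.baseChange_surjective p.asIdeal.ResidueField W.mkQ_surjective y
  obtain ⟨z, rfl⟩ := h p x
  rw [← LinearMap.comp_apply, ← LinearMap.baseChange_comp,
    show W.mkQ ∘ₗ W.subtype = 0 by ext; simp]
  simp

/-! ### The basis of paths. -/

namespace QuiverRep

variable {I : Type v} [Quiver.{w} I] (R : Type u) [CommRing R] [Algebra ℂ R] (m : I → ℕ)

/-- The basis of `R ⊗ ⨁_i (I_i^*)^{⊕ m_i}` at the vertex `j`, indexed by the paths ending at `j`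
which start at one of the framing vectors. -/
def pathBasis (j : I) : Module.Basis (Σ a : Σ i : I, Fin (m i), Quiver.Path a.1 j) R
    (((framingRep ℂ m).baseChange R).obj j) :=
  Algebra.TensorProduct.basis R (DFinsupp.basis fun _ => Finsupp.basisSingleOne)

variable {m}

open scoped Classical in
-- The second tensor factor does not depend on `R`, so the path bases over different rings can be
-- compared.
lemma pathBasis_apply {j : I} (a : Σ i : I, Fin (m i)) (p : Quiver.Path a.1 j) :
    pathBasis R m j ⟨a, p⟩ = (1 : R) ⊗ₜ[ℂ] (DirectSum.lof ℂ (Σ i : I, Fin (m i))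
      (fun a => (dualInjective ℂ a.1).obj j) a (Finsupp.single p (1 : ℂ))) := by
  refine (Algebra.TensorProduct.basis_apply _ _).trans (congrArg (fun x => (1 : R) ⊗ₜ[ℂ] x) ?_)
  refine (DFinsupp.basis_apply (fun a : Σ i : I, Fin (m i) =>
    (Finsupp.basisSingleOne : Module.Basis (Quiver.Path a.1 j) ℂ _)) a p).trans ?_
  rw [Finsupp.coe_basisSingleOne]
  rfl

lemma map_pathBasis {j k : I} (e : j ⟶ k) (a : Σ i : I, Fin (m i)) (p : Quiver.Path a.1 j) :
    ((framingRep ℂ m).baseChange R).map e (pathBasis R m j ⟨a, p⟩) =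
      pathBasis R m k ⟨a, p.cons e⟩ := by
  classical
  rw [pathBasis_apply, pathBasis_apply]
  refine (LinearMap.baseChange_tmul ..).trans (congrArg (fun x => (1 : R) ⊗ₜ[ℂ] x) ?_)
  refine (DirectSum.lmap_lof ..).trans ?_
  exact congrArg _ (Finsupp.mapDomain_single ..)

end QuiverRep

/-! ### Stability versus generation, and the evaluation map. -/

namespace FramedRep

variable {I : Type v} [Quiver.{w} I] {R : Type u} [CommRing R] {m : I → ℕ}

/-- The action of a path on a representation. -/
def act (X : FramedRep.{u, v, w, w'} R m) {i : I} : ∀ {j : I}, Quiver.Path i j →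
    X.obj i →ₗ[R] X.obj j
  | _, .nil => LinearMap.id
  | _, .cons p e => X.map e ∘ₗ act X p

/-- The framing vector with index `a`. -/
def framingVec (X : FramedRep.{u, v, w, w'} R m) (a : Σ i : I, Fin (m i)) : X.obj a.1 :=
  X.framing a.1 (Pi.single a.2 1)

/-- A framed representation is generated by its framing if no proper subrepresentation contains
the images of the framing maps. -/
def IsGenerated (X : FramedRep.{u, v, w, w'} R m) : Prop :=
  ∀ W : ∀ i, Submodule R (X.obj i),
    (∀ ⦃i j : I⦄ (e : i ⟶ j), W i ≤ (W j).comap (X.map e)) →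
    (∀ i, LinearMap.range (X.framing i) ≤ W i) → ∀ i, W i = ⊤

lemma range_framing_le_iff (X : FramedRep.{u, v, w, w'} R m) {i : I}
    (W : Submodule R (X.obj i)) :
    LinearMap.range (X.framing i) ≤ W ↔ ∀ l, X.framingVec ⟨i, l⟩ ∈ W := by
  refine ⟨fun h l => h ⟨_, rfl⟩, ?_⟩
  rintro h _ ⟨x, rfl⟩
  rw [pi_eq_sum_univ' x, map_sum]
  refine W.sum_mem fun l _ => ?_
  rw [map_smul]
  exact W.smul_mem _ (h l)

lemma framingVec_baseChange (X : FramedRep.{u, v, w, w'} R m) (S : Type*) [CommRing S]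
    [Algebra R S] (a : Σ i : I, Fin (m i)) :
    (X.baseChange S).framingVec a = (1 : S) ⊗ₜ[R] X.framingVec a := by
  exact (Fintype.linearCombination_apply_single S (M := S ⊗[R] X.obj a.1)
    (fun l => (1 : S) ⊗ₜ[R] X.framingVec ⟨a.1, l⟩) a.2 1).trans (one_smul ..)

lemma act_baseChange (X : FramedRep.{u, v, w, w'} R m) (S : Type*) [CommRing S]
    [Algebra R S] {i j : I} (p : Quiver.Path i j) (x : X.obj i) :
    (X.baseChange S).act p ((1 : S) ⊗ₜ[R] x : S ⊗[R] X.obj i) =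
      ((1 : S) ⊗ₜ[R] X.act p x : S ⊗[R] X.obj j) := by
  induction p with
  | nil => rfl
  | cons p e ih =>
    change (X.baseChange S).map e ((X.baseChange S).act p _) = _
    rw [ih]
    exact LinearMap.baseChange_tmul ..

/-- A subrepresentation of the fibre pulls back along `x ↦ 1 ⊗ x` to one of `X` containing the
framing, hence to all of `X`; and the vectors `1 ⊗ x` span the fibre over `K`. -/
lemma IsGenerated.isStable_baseChange {X : FramedRep.{u, v, w, w'} R m} (hX : X.IsGenerated)
    (K : Type u) [Field K] [Algebra R K] : (X.baseChange K).IsStable := by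
  intro W hW hf i
  let W' : ∀ i, Submodule R (X.obj i) := fun i =>
    let V : Submodule K (K ⊗[R] X.obj i) := W i
    (V.restrictScalars R).comap (TensorProduct.mk R K (X.obj i) 1)
  have h : W' i = ⊤ := by
    refine hX W' ?_ ?_ i
    · intro i j e x hx
      have : (X.baseChange K).map e ((1 : K) ⊗ₜ[R] x : K ⊗[R] X.obj i) ∈ W j := hW e hx
      exact (congrArg (· ∈ W j) (LinearMap.baseChange_tmul (A := K) (f := X.map e) 1 x)).mp this
    · intro i
      rw [range_framing_le_iff]
      intro l
      have := (range_framing_le_iff (X.baseChange K) _).1 (hf i) l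
      rw [framingVec_baseChange] at this
      exact this
  rw [eq_top_iff]
  intro x _
  change K ⊗[R] X.obj i at x
  induction x using TensorProduct.induction_on with
  | zero => exact (W i).zero_mem
  | add x y hx hy => exact (W i).add_mem (hx trivial) (hy trivial)
  | tmul c x =>
    have hx : x ∈ W' i := h ▸ Submodule.mem_top
    have := (W i).smul_mem c hx
    have e : c • ((1 : K) ⊗ₜ[R] x : K ⊗[R] X.obj i) = c ⊗ₜ[R] x := by
      rw [TensorProduct.smul_tmul', smul_eq_mul, mul_one]
    exact e ▸ this

/-- By Nakayama, it is enough to look at the fibres over the residue fields, where the images of the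
`K ⊗ W i` form a subrepresentation containing the framing. -/
lemma IsStableFamily.isGenerated {n : I → ℕ} {X : FramedRep.{u, v, w, w'} R m}
    (hX : X.IsStableFamily n) : X.IsGenerated := by
  intro W hW hf i
  have := hX.finite i
  refine Submodule.eq_top_of_surjective_baseChange_residueField _ fun p => ?_
  let K := p.asIdeal.ResidueField
  -- The range is taken because `K ⊗ W i → K ⊗ X.obj i` need not be injective.
  let W' : ∀ i, Submodule K ((X.baseChange K).obj i) := fun i =>
    LinearMap.range ((W i).subtype.baseChange K)
  have h : W' i = ⊤ := by
    refine hX.stable K W' ?_ ?_ i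
    · rintro i j e _ ⟨x, rfl⟩
      have key : (X.map e).baseChange K ∘ₗ (W i).subtype.baseChange K =
          (W j).subtype.baseChange K ∘ₗ ((X.map e).restrict (hW e)).baseChange K := by
        rw [← LinearMap.baseChange_comp, ← LinearMap.baseChange_comp]
        rfl
      exact ⟨((X.map e).restrict (hW e)).baseChange K x, (LinearMap.congr_fun key x).symm⟩
    · intro i
      rw [range_framing_le_iff]
      intro l
      rw [framingVec_baseChange]
      exact ⟨1 ⊗ₜ ⟨_, hf i ⟨_, rfl⟩⟩, LinearMap.baseChange_tmul ..⟩
  exact LinearMap.range_eq_top.1 h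

variable [Algebra ℂ R]

/-- The morphism from `R ⊗ ⨁_i (I_i^*)^{⊕ m_i}` determined by the framing. -/
def ev (X : FramedRep.{u, v, w, w'} R m) (j : I) :
    ((QuiverRep.framingRep ℂ m).baseChange R).obj j →ₗ[R] X.obj j :=
  (QuiverRep.pathBasis R m j).constr R fun b => X.act b.2 (X.framingVec b.1)

@[simp]
lemma ev_pathBasis (X : FramedRep.{u, v, w, w'} R m) {j : I} (a : Σ i : I, Fin (m i))
    (p : Quiver.Path a.1 j) :
    X.ev j (QuiverRep.pathBasis R m j ⟨a, p⟩) = X.act p (X.framingVec a) :=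
  (QuiverRep.pathBasis R m j).constr_basis R _ _

lemma ev_map (X : FramedRep.{u, v, w, w'} R m) {i j : I} (e : i ⟶ j)
    (x : ((QuiverRep.framingRep ℂ m).baseChange R).obj i) :
    X.ev j (((QuiverRep.framingRep ℂ m).baseChange R).map e x) = X.map e (X.ev i x) := by
  have : X.ev j ∘ₗ ((QuiverRep.framingRep ℂ m).baseChange R).map e = X.map e ∘ₗ X.ev i := by
    refine (QuiverRep.pathBasis R m i).ext fun ⟨a, p⟩ => ?_
    rw [LinearMap.comp_apply, QuiverRep.map_pathBasis, ev_pathBasis, LinearMap.comp_apply,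
      ev_pathBasis]
    rfl
  exact LinearMap.congr_fun this x

lemma IsGenerated.ev_surjective {X : FramedRep.{u, v, w, w'} R m} (hX : X.IsGenerated) (i : I) :
    Function.Surjective (X.ev i) := by
  rw [← LinearMap.range_eq_top]
  refine hX (fun i => LinearMap.range (X.ev i)) ?_ ?_ i
  · rintro i j e _ ⟨x, rfl⟩
    exact ⟨_, X.ev_map e x⟩
  · intro i
    rw [range_framing_le_iff]
    exact fun l => ⟨_, X.ev_pathBasis ⟨i, l⟩ .nil⟩

/-- Consequently `ker ev` depends only on the isomorphism class of `X`. -/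
lemma Iso.ev {X Y : FramedRep.{u, v, w, w'} R m} (a : Iso X Y) (j : I)
    (x : ((QuiverRep.framingRep ℂ m).baseChange R).obj j) :
    a.equiv j (X.ev j x) = Y.ev j x := by
  have : (a.equiv j).toLinearMap ∘ₗ X.ev j = Y.ev j := by
    refine (QuiverRep.pathBasis R m j).ext fun b => ?_
    obtain ⟨b, p⟩ := b
    rw [LinearMap.comp_apply, ev_pathBasis, ev_pathBasis]
    change a.equiv j _ = _
    clear x
    induction p with
    | nil => exact a.comm_framing _ _
    | cons p e ih => exact (a.comm_map e _).trans (congrArg (Y.map e) ih)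
  exact LinearMap.congr_fun this x

end FramedRep

/-! ### Points of the Grassmannian as quotients of the free representation. -/

namespace QuiverGrassmannian

variable {I : Type v} [Quiver.{w} I] {n m : I → ℕ} {R : Type u} [CommRing R] [Algebra ℂ R]

/-- The quotient of `R ⊗ ⨁_i (I_i^*)^{⊕ m_i}` by a point of the quiver Grassmannian, framed by the
classes of the empty paths. -/
def quotientRep (N : QuiverGrassmannian (QuiverRep.framingRep ℂ m) n R) :
    FramedRep R m where
  obj i := ((QuiverRep.framingRep ℂ m).baseChange R).obj i ⧸ (N.1 i).toSubmodule
  map e := Submodule.mapQ _ _ (((QuiverRep.framingRep ℂ m).baseChange R).map e) (N.2 e)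
  framing i := Fintype.linearCombination R fun l =>
    (N.1 i).toSubmodule.mkQ (QuiverRep.pathBasis R m i ⟨⟨i, l⟩, .nil⟩)

/-- This recovers `N` from its quotient, as the kernel of `ev`. -/
lemma ev_quotientRep (N : QuiverGrassmannian (QuiverRep.framingRep ℂ m) n R) (j : I) :
    N.quotientRep.ev j = (N.1 j).toSubmodule.mkQ := by
  refine (QuiverRep.pathBasis R m j).ext fun b => ?_
  obtain ⟨a, p⟩ := b
  rw [FramedRep.ev_pathBasis]
  induction p with
  | nil =>
    exact (Fintype.linearCombination_apply_single R (fun l =>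
      (N.1 a.1).toSubmodule.mkQ (QuiverRep.pathBasis R m a.1 ⟨⟨a.1, l⟩, .nil⟩)) a.2 1).trans
      (one_smul ..)
  | cons p e ih =>
    refine (congrArg (N.quotientRep.map e) ih).trans ?_
    rw [← QuiverRep.map_pathBasis]
    rfl

/-- By induction on its length, the class of every path lies in any subrepresentation containing the
framing, and these classes span the quotient. -/
lemma isGenerated_quotientRep (N : QuiverGrassmannian (QuiverRep.framingRep ℂ m) n R) :
    N.quotientRep.IsGenerated := by
  intro W hW hf i
  have h : (W i).comap (N.quotientRep.ev i) = ⊤ := by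
    rw [eq_top_iff, ← (QuiverRep.pathBasis R m i).span_eq, Submodule.span_le]
    rintro _ ⟨⟨a, p⟩, rfl⟩
    change N.quotientRep.ev i _ ∈ W i
    rw [FramedRep.ev_pathBasis]
    induction p with
    | nil => exact hf _ ⟨_, rfl⟩
    | cons p e ih => exact hW e ih
  rw [eq_top_iff]
  intro x _
  obtain ⟨y, rfl⟩ := (N.1 i).toSubmodule.mkQ_surjective x
  rw [← ev_quotientRep]
  exact (h ▸ Submodule.mem_top : y ∈ (W i).comap (N.quotientRep.ev i))

lemma isStableFamily_quotientRep (N : QuiverGrassmannian (QuiverRep.framingRep ℂ m) n R) :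
    N.quotientRep.IsStableFamily n where
  finite i := (N.1 i).finite_quotient
  projective i := (N.1 i).projective_quotient
  rank_eq i := (N.1 i).rankAtStalk_eq
  stable K _ _ := N.isGenerated_quotientRep.isStable_baseChange K

/-- A framed representation generated by its framing is the quotient by the kernel of `ev`. -/
def quotientRepIso (N : QuiverGrassmannian (QuiverRep.framingRep ℂ m) n R)
    (X : FramedRep R m) (hX : X.IsGenerated)
    (hN : ∀ i, (N.1 i).toSubmodule = LinearMap.ker (X.ev i)) : N.quotientRep.Iso X where
  equiv i := (Submodule.quotEquivOfEq _ _ (hN i)).trans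
    ((X.ev i).quotKerEquivOfSurjective (hX.ev_surjective i))
  comm_map i j e x := by
    obtain ⟨y, rfl⟩ := (N.1 i).toSubmodule.mkQ_surjective x
    exact X.ev_map e y
  comm_framing i x := by
    have : ((Submodule.quotEquivOfEq _ _ (hN i)).trans ((X.ev i).quotKerEquivOfSurjective
        (hX.ev_surjective i))).toLinearMap ∘ₗ N.quotientRep.framing i = X.framing i := by
      ext l
      change ((Submodule.quotEquivOfEq _ _ (hN i)).trans ((X.ev i).quotKerEquivOfSurjective
        (hX.ev_surjective i))) (N.quotientRep.framingVec ⟨i, l⟩) = X.framingVec ⟨i, l⟩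
      have h := N.quotientRep.ev_pathBasis ⟨i, l⟩ .nil
      rw [ev_quotientRep] at h
      exact (congrArg _ h.symm).trans (X.ev_pathBasis ⟨i, l⟩ .nil)
    exact LinearMap.congr_fun this x

/-- Both maps are `S`-linear and agree on the path basis. The kernel of the right-hand side is the
pulled-back point of the Grassmannian, so this yields naturality. -/
lemma ev_baseChange_quotientRep {S : Type u} [CommRing S] [Algebra ℂ S] [Algebra R S]
    [IsScalarTower ℂ R S] (N : QuiverGrassmannian (QuiverRep.framingRep ℂ m) n R) (j : I) :
    (N.quotientRep.baseChange S).ev j =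
      Module.Grassmannian.baseChangeMkQ S (N.1 j).toSubmodule := by
  refine (QuiverRep.pathBasis S m j).ext fun b => ?_
  obtain ⟨a, p⟩ := b
  rw [FramedRep.ev_pathBasis, FramedRep.framingVec_baseChange]
  refine (FramedRep.act_baseChange ..).trans ?_
  classical
  rw [← FramedRep.ev_pathBasis, ev_quotientRep, QuiverRep.pathBasis_apply,
    QuiverRep.pathBasis_apply]
  symm
  refine (congrArg ((N.1 j).toSubmodule.mkQ.baseChange S)
    (AlgebraTensorModule.cancelBaseChange_symm_tmul ℂ R S (1 : S) _)).trans ?_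
  exact LinearMap.baseChange_tmul ..

/-- The isomorphism intertwines the two maps `ev`, which are the projections with kernels `N` and
`N'`. -/
lemma eq_of_iso {N N' : QuiverGrassmannian (QuiverRep.framingRep ℂ m) n R}
    (a : N.quotientRep.Iso N'.quotientRep) : N = N' := by
  refine Subtype.ext (funext fun i => Module.Grassmannian.ext ?_)
  ext x
  rw [← (N.1 i).toSubmodule.ker_mkQ, ← (N'.1 i).toSubmodule.ker_mkQ, ← ev_quotientRep,
    ← ev_quotientRep]
  change N.quotientRep.ev i x = 0 ↔ N'.quotientRep.ev i x = 0
  rw [← a.ev]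
  exact (LinearEquiv.map_eq_zero_iff _).symm

/-- The kernel of `ev`, as a point of the quiver Grassmannian. -/
def ofStableFamily {X : FramedRep R m} (hX : X.IsStableFamily n) :
    QuiverGrassmannian (QuiverRep.framingRep ℂ m) n R :=
  have e i := (X.ev i).quotKerEquivOfSurjective (hX.isGenerated.ev_surjective i)
  ⟨fun i =>
    { toSubmodule := LinearMap.ker (X.ev i)
      finite_quotient := have := hX.finite i; Module.Finite.equiv (e i).symm
      projective_quotient := have := hX.projective i; Module.Projective.of_equiv (e i).symm
      rankAtStalk_eq p := by rw [Module.rankAtStalk_eq_of_equiv (e i), hX.rank_eq] },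
    fun i j e x hx => by
      change X.ev j _ = 0
      rw [X.ev_map, show X.ev i x = 0 from hx, map_zero]⟩

end QuiverGrassmannian

/-- The transformation sending a point of the quiver Grassmannian to the corresponding quotient. -/
def quiverGrassmannianToStableModuli {I : Type u} [Quiver.{u} I] (n m : I → ℕ) :
    quiverGrassmannian.{u} (QuiverRep.framingRep ℂ m) n ⋙ uliftFunctor.{u + 1} ⟶
      stableModuli.{u} n m where
  app R := ↾fun N => Quotient.mk (StableFamily.setoid n m R)
    ⟨QuiverGrassmannian.quotientRep N.down, QuiverGrassmannian.isStableFamily_quotientRep N.down⟩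
  naturality R S f := by
    ext ⟨N⟩
    let : Algebra R S := f.hom.toAlgebra
    have : IsScalarTower ℂ R S :=
      IsScalarTower.of_algebraMap_eq' <| IsScalarTower.algebraMap_eq ℂ R S
    -- The quotient by the pulled-back point is identified with the base change of the quotient, by
    -- comparing kernels of `ev`.
    exact Quotient.sound ⟨QuiverGrassmannian.quotientRepIso _ _
      (FramedRep.IsStableFamily.isGenerated
        ((QuiverGrassmannian.isStableFamily_quotientRep N).baseChange S))
      fun i => congrArg LinearMap.ker
        (QuiverGrassmannian.ev_baseChange_quotientRep (S := S) N i).symm⟩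

end

theorem proposition2p5 {I : Type u} [Quiver.{u} I] (n m : I → ℕ) :
    Nonempty
      (quiverGrassmannian.{u} (QuiverRep.framingRep ℂ m) n ⋙ uliftFunctor.{u + 1} ≅
        stableModuli.{u} n m) := by
  have h (R) : IsIso ((quiverGrassmannianToStableModuli n m).app R) := by
    rw [isIso_iff_bijective]
    constructor
    · rintro ⟨N⟩ ⟨N'⟩ hN
      obtain ⟨a⟩ := Quotient.exact hN
      exact congrArg ULift.up (QuiverGrassmannian.eq_of_iso a)
    · intro x
      induction x using Quotient.inductionOn with
      | h X =>
        -- The preimage of the class of `X` is `ker ev`, so the condition on kernels holds by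
        -- definition.
        exact ⟨⟨QuiverGrassmannian.ofStableFamily X.2⟩, Quotient.sound
          ⟨QuiverGrassmannian.quotientRepIso _ _ X.2.isGenerated fun _ => rfl⟩⟩
  have := NatIso.isIso_of_isIso_app (quiverGrassmannianToStableModuli n m)
  exact ⟨asIso (quiverGrassmannianToStableModuli n m)⟩
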